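/- Let $M$ be a paracompact $C^\infty$ manifold of finite dimension; all objects below are $C^\infty$. A vector $1$-form on $M$ is a section of $\mathrm{End}(TM)$, and the Frölicher–Nijenhuis bracket of two vector $1$-forms $K,N$ is the vector $2$-form $$[K,N](X,Y)=[KX,NY]+[NX,KY]+KN[X,Y]+NK[X,Y]-K[NX,Y]-K[X,NY]-N[KX,Y]-N[X,KY]$$ for all vector fields $X,Y$. Let $L$ be a vector $1$-form on $M$ such that $\frac12[L,L]=0$ and $\mathrm{Im}(L_z)=\mathrm{Ker}(L_z)$ for every $z\in M$ (so that $\dim M=2n$ is even and $L$ has constant rank $n$). Let $\Gamma$ be an $L$-connection on $M$, that is, a vector $1$-form with $L\Gamma=L$ and $\Gamma L=-L$. Put $h=\frac12(I+\Gamma)$, let $T=\frac12[L,\Gamma]$ be the torsion of $\Gamma$ and $R=-\frac12[h,h]$ its curvature, and let $F$ be the almost-complex structure associated to $\Gamma$, that is, the unique vector $1$-form with $FL=h$ and $Fh=-L$. Then the following assertions are equivalent: (a) $F$ is integrable, in the sense that $[F,F]=0$; (b) $T=0$ and $R=0$; (c) $[L,F]=0$; (d) $[h,F]=0$. -/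

import Mathlib

open scoped Manifold ContDiff Bundle

namespace LConn

noncomputable section

/-! ### Linear algebra in one tangent space -/

section Algebra

variable {V : Type*} [AddCommGroup V] [Module ℝ V]

theorem image_of_vertical {L Γ : V →ₗ[ℝ] V} (hL : ∀ x, L x = 0 ↔ ∃ y, L y = x)
    (h1 : ∀ x, L (Γ x) = L x) (x : V) : ∃ y, L y = x - Γ x := by
  rw [← hL, map_sub, h1, sub_self]

/-- Pointwise existence of the associated almost-complex structure. -/
theorem exists_pointwise (L Γ : V →ₗ[ℝ] V) (hL : ∀ x, L x = 0 ↔ ∃ y, L y = x)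
    (h1 : ∀ x, L (Γ x) = L x) (h2 : ∀ x, Γ (L x) = - L x) :
    ∃ F : V →ₗ[ℝ] V, (∀ x, F (L x) = (1 / 2 : ℝ) • (x + Γ x)) ∧
      (∀ x, F ((1 / 2 : ℝ) • (x + Γ x)) = - L x) := by
  obtain ⟨G', hG'⟩ := L.rangeRestrict.exists_rightInverse_of_surjective L.range_rangeRestrict
  obtain ⟨G, hG⟩ := G'.exists_extend
  have hLG : ∀ x, L (G (L x)) = L x := by
    intro x
    have a : G (L x) = G' (L.rangeRestrict x) := by
      rw [← hG]; rfl
    have b := LinearMap.congr_fun hG' (L.rangeRestrict x)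
    rw [a]
    exact congrArg Subtype.val b
  have hLL : ∀ x, L (L x) = 0 := fun x => (hL _).2 ⟨x, rfl⟩
  have hker : ∀ x, L x = 0 → x + Γ x = 0 := by
    intro x hx
    obtain ⟨y, rfl⟩ := (hL x).1 hx
    rw [h2, add_neg_cancel]
  have hΓ : ∀ x, Γ (Γ x) = x := by
    intro x
    have := hker (x - Γ x) (by rw [map_sub, h1, sub_self])
    rw [map_sub] at this
    have h3 : x - Γ (Γ x) = 0 := by rw [← this]; abel
    exact (sub_eq_zero.1 h3).symm
  refine ⟨((1 / 2 : ℝ) • (LinearMap.id + Γ)) ∘ₗ G ∘ₗ ((1 / 2 : ℝ) • (LinearMap.id - Γ)) - L,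
    fun x => ?_, fun x => ?_⟩
  · have e : (1 / 2 : ℝ) • (L x - Γ (L x)) = L x := by rw [h2]; module
    have k := hker (G (L x) - x) (by rw [map_sub, hLG, sub_self])
    rw [map_sub] at k
    have k' : G (L x) + Γ (G (L x)) = x + Γ x := by
      rw [← sub_eq_zero, ← k]; abel
    simp only [LinearMap.sub_apply, LinearMap.comp_apply, LinearMap.smul_apply,
      LinearMap.add_apply, LinearMap.id_apply, e, k', hLL, sub_zero]
  · have e : (1 / 2 : ℝ) • ((1 / 2 : ℝ) • (x + Γ x) - Γ ((1 / 2 : ℝ) • (x + Γ x))) = 0 := by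
      rw [map_smul, map_add, hΓ]; module
    have l : L ((1 / 2 : ℝ) • (x + Γ x)) = L x := by
      rw [map_smul, map_add, h1]; module
    rw [LinearMap.sub_apply, LinearMap.comp_apply, LinearMap.comp_apply, l, LinearMap.smul_apply,
      LinearMap.smul_apply, LinearMap.sub_apply, LinearMap.id_apply, e, map_zero, map_zero, smul_zero, zero_sub]

/-- Pointwise: `L F = v`, in the form `L F x + h x = x`. -/
theorem comp_pointwise {L Γ F : V →ₗ[ℝ] V} (hL : ∀ x, L x = 0 ↔ ∃ y, L y = x)
    (h1 : ∀ x, L (Γ x) = L x)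
    (hF1 : ∀ x, F (L x) = (1 / 2 : ℝ) • (x + Γ x))
    (hF2 : ∀ x, F ((1 / 2 : ℝ) • (x + Γ x)) = - L x) (x : V) :
    L (F x) + (1 / 2 : ℝ) • (x + Γ x) = x := by
  obtain ⟨y, hy⟩ := image_of_vertical hL h1 x
  have hLL : L (L x) = 0 := (hL _).2 ⟨x, rfl⟩
  have e : x = (1 / 2 : ℝ) • (x + Γ x) + (1 / 2 : ℝ) • L y := by rw [hy]; module
  have : L (F x) = (1 / 2 : ℝ) • L y := by
    conv_lhs => rw [e]
    rw [map_add, hF2, map_smul, hF1, map_add, map_neg, hLL, map_smul, map_smul, map_add, h1]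
    module
  rw [this, add_comm]; exact e.symm

/-- Pointwise uniqueness of the associated almost-complex structure. -/
theorem unique_pointwise {L Γ F F' : V →ₗ[ℝ] V} (hL : ∀ x, L x = 0 ↔ ∃ y, L y = x)
    (h1 : ∀ x, L (Γ x) = L x)
    (hF1 : ∀ x, F (L x) = (1 / 2 : ℝ) • (x + Γ x))
    (hF2 : ∀ x, F ((1 / 2 : ℝ) • (x + Γ x)) = - L x)
    (hF1' : ∀ x, F' (L x) = (1 / 2 : ℝ) • (x + Γ x))
    (hF2' : ∀ x, F' ((1 / 2 : ℝ) • (x + Γ x)) = - L x) (x : V) : F x = F' x := by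
  obtain ⟨y, hy⟩ := image_of_vertical hL h1 x
  have e : x = (1 / 2 : ℝ) • (x + Γ x) + (1 / 2 : ℝ) • L y := by rw [hy]; module
  rw [e, map_add, map_add, hF2, hF2', map_smul, map_smul, hF1, hF1']

end Algebra

/-! ### Vector fields and vector forms -/

variable (E : Type*) [NormedAddCommGroup E] [NormedSpace ℝ E]
variable (M : Type*) [TopologicalSpace M] [ChartedSpace E M] [IsManifold 𝓘(ℝ, E) ∞ M]

/-- The real vector space of `C^∞` vector fields on the manifold `M`. -/
abbrev VectorField : Type _ :=
  ContMDiffSection 𝓘(ℝ, E) E ∞ (fun x : M => TangentSpace 𝓘(ℝ, E) x)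

/-- The real vector space of vector `1`-forms on `M`: `C^∞` sections of the bundle
`End(TM)` of endomorphisms of the tangent bundle. -/
abbrev VectorOneForm : Type _ :=
  ContMDiffSection 𝓘(ℝ, E) (E →L[ℝ] E) ∞
    (fun x : M => TangentSpace 𝓘(ℝ, E) x →L[ℝ] TangentSpace 𝓘(ℝ, E) x)

variable {E M}

/-- The vector field `K X` obtained by applying a vector `1`-form `K` to a vector field `X`. -/
def app (K : VectorOneForm E M) (X : VectorField E M) : VectorField E M where
  toFun z := K z (X z)
  contMDiff_toFun := fun z => (K.contMDiff z).clm_bundle_apply (X.contMDiff z)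

/-- The Lie bracket `[X, Y]` of two `C^∞` vector fields. -/
def lie [FiniteDimensional ℝ E] (X Y : VectorField E M) : VectorField E M where
  toFun := VectorField.mlieBracket 𝓘(ℝ, E) X Y
  contMDiff_toFun := by
    have : CompleteSpace E := FiniteDimensional.complete ℝ E
    have : IsManifold 𝓘(ℝ, E) (((⊤ : ℕ∞) : WithTop ℕ∞) + 1) M := by
      simpa using (inferInstance : IsManifold 𝓘(ℝ, E) ∞ M)
    have : IsManifold 𝓘(ℝ, E) (minSmoothness ℝ 2) M := by
      rw [minSmoothness_of_isRCLikeNormedField]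
      infer_instance
    exact ContDiff.mlieBracket_vectorField (m := ⊤) (n := ⊤) X.contMDiff Y.contMDiff (by simp)

/-- The Frölicher–Nijenhuis bracket `[K, N]` of two vector `1`-forms. It is a vector `2`-form,
given here by its values on pairs of vector fields. -/
def fnBracket [FiniteDimensional ℝ E] (K N : VectorOneForm E M) :
    VectorField E M → VectorField E M → VectorField E M := fun X Y =>
  lie (app K X) (app N Y) + lie (app N X) (app K Y)
    + app K (app N (lie X Y)) + app N (app K (lie X Y))
    - app K (lie (app N X) Y) - app K (lie X (app N Y))
    - app N (lie (app K X) Y) - app N (lie X (app K Y))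

/-! ### Smoothness of endomorphism fields in coordinates -/

/-- Reading of an endomorphism of `T_z M` in the trivialization of `TM` around `x₀`. -/
def coord (x₀ z : M) (A : TangentSpace 𝓘(ℝ, E) z →L[ℝ] TangentSpace 𝓘(ℝ, E) z) : E →L[ℝ] E :=
  ContinuousLinearMap.inCoordinates E (TangentSpace 𝓘(ℝ, E) (M := M)) E
        (TangentSpace 𝓘(ℝ, E) (M := M)) x₀ z x₀ z A

theorem contMDiff_oneForm_iff
    (A : ∀ x : M, TangentSpace 𝓘(ℝ, E) x →L[ℝ] TangentSpace 𝓘(ℝ, E) x) (x₀ : M) :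
    ContMDiffAt 𝓘(ℝ, E) (𝓘(ℝ, E).prod 𝓘(ℝ, E →L[ℝ] E)) ∞
      (fun x => Bundle.TotalSpace.mk' (E →L[ℝ] E)
        (E := fun x : M => TangentSpace 𝓘(ℝ, E) x →L[ℝ] TangentSpace 𝓘(ℝ, E) x) x (A x)) x₀ ↔
    ContMDiffAt 𝓘(ℝ, E) 𝓘(ℝ, E →L[ℝ] E) ∞ (fun x => coord x₀ x (A x)) x₀ := by
  rw [contMDiffAt_hom_bundle]
  exact ⟨fun h => h.2, fun h => ⟨contMDiffAt_id, h⟩⟩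

/-- In a trivialization, `coord` is conjugation by a linear isomorphism. -/
theorem exists_coord_eq (x₀ : M) : ∀ᶠ z in nhds x₀,
    ∃ e : TangentSpace 𝓘(ℝ, E) z ≃L[ℝ] E, ∀ A u, coord x₀ z A u = e (A (e.symm u)) := by
  filter_upwards [(trivializationAt E (TangentSpace 𝓘(ℝ, E) (M := M)) x₀).open_baseSet.mem_nhds
    (FiberBundle.mem_baseSet_trivializationAt' x₀)] with z hz
  refine ⟨(trivializationAt E (TangentSpace 𝓘(ℝ, E) (M := M)) x₀).continuousLinearEquivAt ℝ z hz,
    fun A u => ?_⟩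
  rw [coord, ContinuousLinearMap.inCoordinates_eq hz hz]
  rfl

variable (E M) in
/-- The identity vector `1`-form `I`. -/
def one : VectorOneForm E M where
  toFun z := ContinuousLinearMap.id ℝ (TangentSpace 𝓘(ℝ, E) z)
  contMDiff_toFun := fun x₀ => by
    refine (contMDiff_oneForm_iff _ x₀).2 ?_
    refine (contMDiffAt_const (c := ContinuousLinearMap.id ℝ E)).congr_of_eventuallyEq ?_
    filter_upwards [exists_coord_eq (E := E) x₀] with z hz
    obtain ⟨e, he⟩ := hz
    ext u
    rw [he]
    simp

/-! ### `L`-connections -/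

/-- The standing assumptions on `L`: its Nijenhuis tensor `½[L, L]` vanishes and
`Im L_z = Ker L_z` at every point `z`. -/
structure IsAlmostTangent [FiniteDimensional ℝ E] (L : VectorOneForm E M) : Prop where
  nijenhuis : (1 / 2 : ℝ) • fnBracket L L = 0
  range_eq_ker : ∀ z : M, (L z).range = (L z).ker

/-- `Γ` is an `L`-connection: `L Γ = L` and `Γ L = -L`. -/
structure IsLConnection (L Γ : VectorOneForm E M) : Prop where
  comp_right : ∀ (z : M) (X : TangentSpace 𝓘(ℝ, E) z), L z (Γ z X) = L z X
  comp_left : ∀ (z : M) (X : TangentSpace 𝓘(ℝ, E) z), Γ z (L z X) = - L z X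

/-- The horizontal projector `h = ½(I + Γ)`. -/
def hor (Γ : VectorOneForm E M) : VectorOneForm E M := (1 / 2 : ℝ) • (one E M + Γ)

theorem hor_apply (Γ : VectorOneForm E M) (z : M) (X : TangentSpace 𝓘(ℝ, E) z) :
    hor Γ z X = (1 / 2 : ℝ) • (X + Γ z X) := rfl

/-- The torsion `T = ½[L, Γ]`. -/
def torsion [FiniteDimensional ℝ E] (L Γ : VectorOneForm E M) :
    VectorField E M → VectorField E M → VectorField E M :=
  (1 / 2 : ℝ) • fnBracket L Γ

/-- The curvature `R = -½[h, h]`. -/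
def curvature [FiniteDimensional ℝ E] (Γ : VectorOneForm E M) :
    VectorField E M → VectorField E M → VectorField E M :=
  -((1 / 2 : ℝ) • fnBracket (hor Γ) (hor Γ))

/-- The equations `F L = h` and `F h = -L` for a vector `1`-form `F`. -/
structure IsAssociated (L Γ F : VectorOneForm E M) : Prop where
  comp_L : ∀ (z : M) (X : TangentSpace 𝓘(ℝ, E) z), F z (L z X) = hor Γ z X
  comp_hor : ∀ (z : M) (X : TangentSpace 𝓘(ℝ, E) z), F z (hor Γ z X) = - L z X

theorem eq_zero_iff_of_range_eq_ker {L : VectorOneForm E M}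
    (h : ∀ z : M, (L z).range = (L z).ker) (z : M) (x : TangentSpace 𝓘(ℝ, E) z) :
    L z x = 0 ↔ ∃ y, L z y = x := by
  have := SetLike.ext_iff.1 (h z) x
  simpa using this.symm

theorem existsUnique_associated [FiniteDimensional ℝ E] {L Γ : VectorOneForm E M}
    (hL : IsAlmostTangent L) (hΓ : IsLConnection L Γ) :
    ∃! F : VectorOneForm E M, IsAssociated L Γ F := by
  have hk := eq_zero_iff_of_range_eq_ker hL.range_eq_ker
  have key : ∀ z : M, ∃ F : TangentSpace 𝓘(ℝ, E) z →L[ℝ] TangentSpace 𝓘(ℝ, E) z,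
      (∀ x, F (L z x) = hor Γ z x) ∧ (∀ x, F (hor Γ z x) = - L z x) := by
    intro z
    have : FiniteDimensional ℝ (TangentSpace 𝓘(ℝ, E) z) :=
      inferInstanceAs (FiniteDimensional ℝ E)
    have : T2Space (TangentSpace 𝓘(ℝ, E) z) := inferInstanceAs (T2Space E)
    obtain ⟨F, hF1, hF2⟩ := exists_pointwise (L z).toLinearMap (Γ z).toLinearMap (hk z)
      (hΓ.comp_right z) (hΓ.comp_left z)
    exact ⟨LinearMap.toContinuousLinearMap F, hF1, hF2⟩
  choose F hF1 hF2 using key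
  have hsmooth : ∀ x₀ : M, ContMDiffAt 𝓘(ℝ, E) 𝓘(ℝ, E →L[ℝ] E) ∞
      (fun x => coord x₀ x (F x)) x₀ := by
    intro x₀
    have : CompleteSpace E := FiniteDimensional.complete ℝ E
    have sL := (contMDiff_oneForm_iff _ x₀).1 (L.contMDiff x₀)
    have sh := (contMDiff_oneForm_iff _ x₀).1 ((hor Γ).contMDiff x₀)
    set C : E →L[ℝ] E := coord x₀ x₀ (F x₀) with hC
    set W : M → E →L[ℝ] E := fun x => (coord x₀ x (L x)).comp C + coord x₀ x (hor Γ x) with hW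
    have sW : ContMDiffAt 𝓘(ℝ, E) 𝓘(ℝ, E →L[ℝ] E) ∞ W x₀ :=
      (sL.clm_comp contMDiffAt_const).add sh
    have W0 : W x₀ = ContinuousLinearMap.id ℝ E := by
      obtain ⟨e, he⟩ := (exists_coord_eq (E := E) x₀).self_of_nhds
      ext u
      have := comp_pointwise (L := (L x₀).toLinearMap) (Γ := (Γ x₀).toLinearMap)
        (F := (F x₀).toLinearMap) (hk x₀) (hΓ.comp_right x₀) (hF1 x₀) (hF2 x₀) (e.symm u)
      simp only [hW, hC, add_apply, ContinuousLinearMap.comp_apply, he,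
        ContinuousLinearEquiv.symm_apply_apply, ← map_add]
      exact (congrArg e this).trans (e.apply_symm_apply u)
    have hinv : ContDiffAt ℝ ∞ (ContinuousLinearMap.inverse : (E →L[ℝ] E) → E →L[ℝ] E) (W x₀) := by
      rw [W0]
      exact contDiffAt_map_inverse (ContinuousLinearEquiv.refl ℝ E)
    have sinv : ContMDiffAt 𝓘(ℝ, E) 𝓘(ℝ, E →L[ℝ] E) ∞
        (fun x => ContinuousLinearMap.inverse (W x)) x₀ :=
      hinv.contMDiffAt.comp x₀ sW
    have evW : ∀ᶠ x in nhds x₀, (W x).IsInvertible := by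
      have o : IsOpen (Set.range ((↑) : (E ≃L[ℝ] E) → E →L[ℝ] E)) :=
        ContinuousLinearEquiv.isOpen
      exact sW.continuousAt.eventually_mem (o.mem_nhds ⟨ContinuousLinearEquiv.refl ℝ E, W0.symm⟩)
    have stot := ((sh.clm_comp (contMDiffAt_const (c := C))).sub sL).clm_comp sinv
    refine stot.congr_of_eventuallyEq ?_
    filter_upwards [evW, exists_coord_eq (E := E) x₀] with x hx hex
    obtain ⟨e, he⟩ := hex
    have eq1 : (coord x₀ x (F x)).comp (W x)
        = (coord x₀ x (hor Γ x)).comp C - coord x₀ x (L x) := by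
      ext u
      simp only [hW, add_apply, ContinuousLinearMap.comp_apply, he, map_add,
        ContinuousLinearEquiv.symm_apply_apply, sub_apply, hF1, hF2, map_neg]
      abel
    have eq2 : (W x).comp (ContinuousLinearMap.inverse (W x)) = ContinuousLinearMap.id ℝ E :=
      hx.self_comp_inverse
    change coord x₀ x (F x) = ((coord x₀ x (hor Γ x)).comp C - coord x₀ x (L x)).comp
      (ContinuousLinearMap.inverse (W x))
    rw [← eq1, ContinuousLinearMap.comp_assoc, eq2, ContinuousLinearMap.comp_id]
  refine ⟨⟨F, fun x₀ => (contMDiff_oneForm_iff _ x₀).2 (hsmooth x₀)⟩, ⟨hF1, hF2⟩, ?_⟩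
  intro F' hF'
  refine ContMDiffSection.ext fun z => ContinuousLinearMap.ext fun x => ?_
  exact unique_pointwise (L := (L z).toLinearMap) (Γ := (Γ z).toLinearMap)
    (F := (F' z).toLinearMap) (F' := (F z).toLinearMap) (hk z) (hΓ.comp_right z)
    (hF'.comp_L z) (hF'.comp_hor z) (hF1 z) (hF2 z) x

/-- The almost-complex structure associated to an `L`-connection `Γ`: the unique vector
`1`-form `F` with `F L = h` and `F h = -L`. -/
def almostComplex [FiniteDimensional ℝ E] {L Γ : VectorOneForm E M}
    (hL : IsAlmostTangent L) (hΓ : IsLConnection L Γ) : VectorOneForm E M :=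
  (existsUnique_associated hL hΓ).choose

theorem almostComplex_isAssociated [FiniteDimensional ℝ E] {L Γ : VectorOneForm E M}
    (hL : IsAlmostTangent L) (hΓ : IsLConnection L Γ) :
    IsAssociated L Γ (almostComplex hL hΓ) :=
  (existsUnique_associated hL hΓ).choose_spec.1

end

end LConn

/-! Acting on vector fields, `L` and `F` satisfy `L² = 0`, `F² = -1` and `F L + L F = 1`, so that
`h = F L` and `v = L F` are complementary projectors. The condition `½[L, L] = 0` rewrites
`[L X, L Y]` as `L ([L X, h Y] + [h X, L Y])`, and this turns every bracket in the theorem into a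
function of the single vector `2`-form `D(X, Y) = ½[F, F](h X, h Y)`: the torsion is `T = L D` and
the curvature is `R = v D`, whence `D = F T + R`, while `[L, F]` and `[h, F]` restrict to `-D` and
`F D` on horizontal fields. Each of the four assertions therefore says that `D = 0`. -/

namespace LConn

/-- The relations between an almost tangent structure `L` and the almost-complex structure `F` of
an `L`-connection, in any ring of endomorphisms. The projectors `h` and `v` of the connection are
not part of the data: they are `F * L` and `L * F`. -/
structure IsAdapted {A : Type*} [Ring A] (L F : A) : Prop where
  L_mul_L : L * L = 0
  F_mul_F : F * F = -1
  F_mul_L_add_L_mul_F : F * L + L * F = 1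

theorem mul_self_eq_neg_one_of_mul_add_mul_eq_one {A : Type*} [Ring A] {L F : A}
    (h : F * L + L * F = 1) (hFL : F * (F * L) = -L) : F * F = -1 :=
  calc F * F = F * F * (F * L + L * F) := by rw [h, mul_one]
    _ = F * (F * (F * L)) + F * (F * L) * F := by noncomm_ring
    _ = -(F * L + L * F) := by rw [hFL]; noncomm_ring
    _ = -1 := by rw [h]

section Bracket

variable {R V : Type*} [CommRing R] [AddCommGroup V] [Module R V]

/-- The insertion of a vector `1`-form `K` into a vector `2`-form `Φ`, for `Φ` a bilinear map and
`K` an endomorphism of a module. -/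
def insertion (Φ : V →ₗ[R] V →ₗ[R] V) (K : Module.End R V) : V →ₗ[R] V →ₗ[R] V :=
  Φ.compl₁₂ K 1 + Φ.compl₁₂ 1 K

/-- The Frölicher–Nijenhuis bracket of two endomorphisms of a module with respect to a bilinear
bracket `B` on it, which stands for the Lie bracket of vector fields. -/
def endBracket (B : V →ₗ[R] V →ₗ[R] V) (K N : Module.End R V) : V →ₗ[R] V →ₗ[R] V :=
  B.compl₁₂ K N + B.compl₁₂ N K + B.compr₂ (K * N + N * K)
    - (insertion B N).compr₂ K - (insertion B K).compr₂ N

/-- The Nijenhuis tensor `½[K, K]` of an endomorphism, written without the division by two. -/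
def nijenhuis (B : V →ₗ[R] V →ₗ[R] V) (K : Module.End R V) : V →ₗ[R] V →ₗ[R] V :=
  B.compl₁₂ K K + B.compr₂ (K * K) - (insertion B K).compr₂ K

/-- The Nijenhuis tensor of `F` evaluated on horizontal vectors, where `F * L` is the horizontal
projector. It equals `F T + R` for the torsion `T` and the curvature `R` of the connection. -/
def horNijenhuis (B : V →ₗ[R] V →ₗ[R] V) (L F : Module.End R V) : V →ₗ[R] V →ₗ[R] V :=
  (nijenhuis B F).compl₁₂ (F * L) (F * L)

variable (B : V →ₗ[R] V →ₗ[R] V)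

theorem insertion_apply (K : Module.End R V) (x y : V) :
    insertion B K x y = B (K x) y + B x (K y) := rfl

theorem endBracket_apply (K N : Module.End R V) (x y : V) :
    endBracket B K N x y = B (K x) (N y) + B (N x) (K y) + (K (N (B x y)) + N (K (B x y)))
      - K (B (N x) y + B x (N y)) - N (B (K x) y + B x (K y)) := rfl

theorem nijenhuis_apply (K : Module.End R V) (x y : V) :
    nijenhuis B K x y = B (K x) (K y) + K (K (B x y)) - K (B (K x) y + B x (K y)) := rfl

theorem horNijenhuis_apply (L F : Module.End R V) (x y : V) :
    horNijenhuis B L F x y = nijenhuis B F (F (L x)) (F (L y)) := rfl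

theorem endBracket_self (K : Module.End R V) : endBracket B K K = (2 : R) • nijenhuis B K := by
  ext x y
  simp only [endBracket_apply, nijenhuis_apply, LinearMap.smul_apply]
  module

theorem endBracket_smul_one_add (K N : Module.End R V) (c : R) :
    endBracket B K (c • (1 + N)) = c • endBracket B K N := by
  ext x y
  simp only [endBracket_apply, LinearMap.smul_apply, LinearMap.add_apply, Module.End.one_apply,
    map_add, map_smul]
  module

namespace IsAdapted

variable {B} {L F : Module.End R V} (H : IsAdapted L F)
include H

theorem L_L (x : V) : L (L x) = 0 := LinearMap.congr_fun H.L_mul_L x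

theorem F_F (x : V) : F (F x) = -x := LinearMap.congr_fun H.F_mul_F x

/-- As a rewrite rule, together with `L_L` and `F_F`, this brings every word in `L` and `F` to a
combination of `1`, `F`, `L` and `F L`, so that `abel` decides the identities below once
`bracket_L_L` has removed the brackets of two vertical vectors. -/
theorem L_F (x : V) : L (F x) = x - F (L x) :=
  eq_sub_of_add_eq' (LinearMap.congr_fun H.F_mul_L_add_L_mul_F x)

theorem ext_hor_ver {Φ Ψ : V →ₗ[R] V →ₗ[R] V}
    (hor_hor : ∀ x y, Φ (F (L x)) (F (L y)) = Ψ (F (L x)) (F (L y)))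
    (hor_ver : ∀ x y, Φ (F (L x)) (L y) = Ψ (F (L x)) (L y))
    (ver_hor : ∀ x y, Φ (L x) (F (L y)) = Ψ (L x) (F (L y)))
    (ver_ver : ∀ x y, Φ (L x) (L y) = Ψ (L x) (L y)) : Φ = Ψ := by
  have split (x : V) : x = F (L x) + L (F x) := by rw [H.L_F, add_sub_cancel]
  ext x y
  rw [split x, split y]
  simp only [map_add, LinearMap.add_apply, hor_hor, hor_ver, ver_hor, ver_ver]

theorem eq_zero_of_L_eq_zero_of_L_F_eq_zero {x : V} (hL : L x = 0) (hLF : L (F x) = 0) :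
    x = 0 := by
  rwa [H.L_F, hL, map_zero, sub_zero] at hLF

theorem horNijenhuis_L_left (x y : V) : horNijenhuis B L F (L x) y = 0 := by
  simp only [horNijenhuis_apply, H.L_L, map_zero, LinearMap.zero_apply]

theorem horNijenhuis_L_right (x y : V) : horNijenhuis B L F x (L y) = 0 := by
  simp only [horNijenhuis_apply, H.L_L, map_zero]

theorem horNijenhuis_hor_hor (x y : V) :
    horNijenhuis B L F (F (L x)) (F (L y)) = horNijenhuis B L F x y := by
  simp only [horNijenhuis_apply, H.L_F, H.L_L, map_zero, sub_zero]

theorem insertion_horNijenhuis_hor_hor (x y : V) :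
    insertion (horNijenhuis B L F) F (F (L x)) (F (L y)) = 0 := by
  simp only [insertion_apply, H.F_F, map_neg, LinearMap.neg_apply, H.horNijenhuis_L_left,
    H.horNijenhuis_L_right, neg_zero, add_zero]

theorem nijenhuis_F :
    nijenhuis B F = horNijenhuis B L F + (insertion (horNijenhuis B L F) F).compr₂ F
      - (horNijenhuis B L F).compl₁₂ F F := by
  refine H.ext_hor_ver ?_ ?_ ?_ ?_ <;> intro x y <;>
  simp only [LinearMap.compr₂_apply, LinearMap.compl₁₂_apply, LinearMap.add_apply,
    LinearMap.sub_apply, insertion_apply, horNijenhuis_apply, nijenhuis_apply, H.L_L, H.L_F,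
    H.F_F, map_add, map_sub, map_neg, map_zero, LinearMap.zero_apply, LinearMap.neg_apply,
    sub_zero] <;> abel

theorem nijenhuis_F_eq_zero_iff : nijenhuis B F = 0 ↔ horNijenhuis B L F = 0 where
  mp h := LinearMap.ext₂ fun x y => LinearMap.congr_fun₂ h (F (L x)) (F (L y))
  mpr h := by ext; simp [H.nijenhuis_F, h, insertion_apply]

section IntegrableL

variable (hL : nijenhuis B L = 0)
include hL

theorem bracket_L_L (x y : V) :
    B (L x) (L y) = L (B (L x) (F (L y)) + B (F (L x)) (L y)) := by
  have h := LinearMap.congr_fun₂ hL (F (L x)) (F (L y))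
  simpa only [nijenhuis_apply, H.L_F, H.L_L, map_zero, sub_zero, add_zero,
    LinearMap.zero_apply, sub_eq_zero] using h

theorem horNijenhuis_eq (x y : V) :
    horNijenhuis B L F x y = (F + L) (B (L x) (F (L y)) + B (F (L x)) (L y))
      - B (F (L x)) (F (L y)) := by
  simp only [horNijenhuis_apply, nijenhuis_apply, H.F_F, map_neg, LinearMap.neg_apply, neg_neg,
    H.bracket_L_L hL, LinearMap.add_apply, map_add]
  abel

theorem endBracket_L_hor : endBracket B L (F * L) = (horNijenhuis B L F).compr₂ L := by
  refine H.ext_hor_ver ?_ ?_ ?_ ?_ <;> intro x y <;>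
  simp only [LinearMap.compr₂_apply, H.horNijenhuis_hor_hor, H.horNijenhuis_L_left,
    H.horNijenhuis_L_right, H.horNijenhuis_eq hL, endBracket_apply, Module.End.mul_apply,
    LinearMap.add_apply, H.bracket_L_L hL, H.L_L, H.L_F, map_add, map_sub, map_zero,
    LinearMap.zero_apply, sub_zero] <;> abel

theorem nijenhuis_hor : nijenhuis B (F * L) = -(horNijenhuis B L F).compr₂ (L * F) := by
  refine H.ext_hor_ver ?_ ?_ ?_ ?_ <;> intro x y <;>
  simp only [LinearMap.compr₂_apply, H.horNijenhuis_hor_hor, H.horNijenhuis_L_left,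
    H.horNijenhuis_L_right, H.horNijenhuis_eq hL, nijenhuis_apply, Module.End.mul_apply,
    LinearMap.add_apply, H.bracket_L_L hL, H.L_L, H.L_F, H.F_F, map_add, map_sub, map_neg,
    map_zero, LinearMap.zero_apply, LinearMap.neg_apply, sub_zero] <;> abel

theorem endBracket_L_F :
    endBracket B L F = (insertion (horNijenhuis B L F) F).compr₂ L - horNijenhuis B L F := by
  refine H.ext_hor_ver ?_ ?_ ?_ ?_ <;> intro x y <;>
  simp only [LinearMap.compr₂_apply, LinearMap.sub_apply, insertion_apply,
    H.horNijenhuis_hor_hor, H.horNijenhuis_L_left, H.horNijenhuis_L_right, H.horNijenhuis_eq hL,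
    endBracket_apply, LinearMap.add_apply, H.bracket_L_L hL, H.L_L, H.L_F, H.F_F, map_add,
    map_sub, map_neg, map_zero, LinearMap.zero_apply, LinearMap.neg_apply, sub_zero] <;> abel

theorem endBracket_hor_F :
    endBracket B (F * L) F = (horNijenhuis B L F).compr₂ F
      - (insertion (horNijenhuis B L F) F).compr₂ (L * F) := by
  refine H.ext_hor_ver ?_ ?_ ?_ ?_ <;> intro x y <;>
  simp only [LinearMap.compr₂_apply, LinearMap.sub_apply, insertion_apply,
    H.horNijenhuis_hor_hor, H.horNijenhuis_L_left, H.horNijenhuis_L_right, H.horNijenhuis_eq hL,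
    endBracket_apply, Module.End.mul_apply, LinearMap.add_apply, H.bracket_L_L hL, H.L_L, H.L_F,
    H.F_F, map_add, map_sub, map_neg, map_zero, LinearMap.zero_apply, LinearMap.neg_apply,
    sub_zero] <;> abel

theorem endBracket_L_hor_and_nijenhuis_hor_eq_zero_iff :
    endBracket B L (F * L) = 0 ∧ nijenhuis B (F * L) = 0 ↔ horNijenhuis B L F = 0 where
  mp := fun ⟨hT, hR⟩ => by
    rw [H.endBracket_L_hor hL] at hT
    rw [H.nijenhuis_hor hL, neg_eq_zero] at hR
    ext x y
    exact H.eq_zero_of_L_eq_zero_of_L_F_eq_zero (LinearMap.congr_fun₂ hT x y)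
      (LinearMap.congr_fun₂ hR x y)
  mpr h := by
    constructor <;> ext <;> simp [H.endBracket_L_hor hL, H.nijenhuis_hor hL, h]

theorem endBracket_L_F_eq_zero_iff : endBracket B L F = 0 ↔ horNijenhuis B L F = 0 where
  mp h := by
    ext x y
    have hor : -horNijenhuis B L F x y = 0 := by
      simpa [H.endBracket_L_F hL, H.insertion_horNijenhuis_hor_hor, H.horNijenhuis_hor_hor]
        using LinearMap.congr_fun₂ h (F (L x)) (F (L y))
    exact neg_eq_zero.1 hor
  mpr h := by ext; simp [H.endBracket_L_F hL, h, insertion_apply]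

theorem endBracket_hor_F_eq_zero_iff :
    endBracket B (F * L) F = 0 ↔ horNijenhuis B L F = 0 where
  mp h := by
    ext x y
    have hor : F (horNijenhuis B L F x y) = 0 := by
      simpa [H.endBracket_hor_F hL, H.insertion_horNijenhuis_hor_hor, H.horNijenhuis_hor_hor]
        using LinearMap.congr_fun₂ h (F (L x)) (F (L y))
    exact neg_eq_zero.1 (by rw [← H.F_F, hor, map_zero])
  mpr h := by ext; simp [H.endBracket_hor_F hL, h, insertion_apply]

theorem tfae_nijenhuis_F_eq_zero :
    List.TFAE [
      nijenhuis B F = 0,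
      endBracket B L (F * L) = 0 ∧ nijenhuis B (F * L) = 0,
      endBracket B L F = 0,
      endBracket B (F * L) F = 0] :=
  List.tfae_of_forall (horNijenhuis B L F = 0) _ <| by
    simp [H.nijenhuis_F_eq_zero_iff, H.endBracket_L_hor_and_nijenhuis_hor_eq_zero_iff hL,
      H.endBracket_L_F_eq_zero_iff hL, H.endBracket_hor_F_eq_zero_iff hL]

end IntegrableL

end IsAdapted

end Bracket

section Manifold

variable {E : Type*} [NormedAddCommGroup E] [NormedSpace ℝ E]
  {M : Type*} [TopologicalSpace M] [ChartedSpace E M] [IsManifold 𝓘(ℝ, E) ∞ M]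

theorem mdifferentiableAt_vectorField (X : VectorField E M) (z : M) :
    MDifferentiableAt 𝓘(ℝ, E) (𝓘(ℝ, E).prod 𝓘(ℝ, E))
      (fun x => Bundle.TotalSpace.mk' E (E := fun x : M => TangentSpace 𝓘(ℝ, E) x) x (X x)) z :=
  (X.contMDiff z).mdifferentiableAt (by simp)

/-- The action of a vector `1`-form on vector fields, as an endomorphism of the real vector space
of vector fields. -/
noncomputable def appEnd (K : VectorOneForm E M) : Module.End ℝ (VectorField E M) where
  toFun := app K
  map_add' X Y := ContMDiffSection.ext fun z => map_add (K z) (X z) (Y z)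
  map_smul' c X := ContMDiffSection.ext fun z => map_smul (K z) c (X z)

theorem appEnd_hor (Γ : VectorOneForm E M) : appEnd (hor Γ) = (1 / 2 : ℝ) • (1 + appEnd Γ) := rfl

theorem IsAssociated.appEnd_mul_appEnd {L Γ F : VectorOneForm E M} (hF : IsAssociated L Γ F) :
    appEnd F * appEnd L = appEnd (hor Γ) :=
  LinearMap.ext fun X => ContMDiffSection.ext fun z => hF.comp_L z (X z)

variable [FiniteDimensional ℝ E]

/-- The Lie bracket of vector fields as an `ℝ`-bilinear map. -/
noncomputable def lieBilin : VectorField E M →ₗ[ℝ] VectorField E M →ₗ[ℝ] VectorField E M :=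
  have : CompleteSpace E := FiniteDimensional.complete ℝ E
  LinearMap.mk₂ ℝ lie
    (fun X X' _ => ContMDiffSection.ext fun z => VectorField.mlieBracket_add_left
      (mdifferentiableAt_vectorField X z) (mdifferentiableAt_vectorField X' z))
    (fun _ X _ => ContMDiffSection.ext fun z => VectorField.mlieBracket_const_smul_left
      (mdifferentiableAt_vectorField X z))
    (fun _ Y Y' => ContMDiffSection.ext fun z => VectorField.mlieBracket_add_right
      (mdifferentiableAt_vectorField Y z) (mdifferentiableAt_vectorField Y' z))
    (fun _ _ Y => ContMDiffSection.ext fun z => VectorField.mlieBracket_const_smul_right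
      (mdifferentiableAt_vectorField Y z))

theorem fnBracket_eq_endBracket (K N : VectorOneForm E M) :
    fnBracket K N = fun X Y => endBracket lieBilin (appEnd K) (appEnd N) X Y := by
  funext X Y
  rw [endBracket_apply, map_add, map_add, ← add_assoc, ← sub_sub, ← sub_sub]
  rfl

theorem fnBracket_eq_zero_iff (K N : VectorOneForm E M) :
    fnBracket K N = 0 ↔ endBracket lieBilin (appEnd K) (appEnd N) = 0 := by
  simp only [fnBracket_eq_endBracket, funext_iff, LinearMap.ext_iff, Pi.zero_apply,
    LinearMap.zero_apply]

theorem fnBracket_self_eq_zero_iff (K : VectorOneForm E M) :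
    fnBracket K K = 0 ↔ nijenhuis lieBilin (appEnd K) = 0 := by
  rw [fnBracket_eq_zero_iff, endBracket_self, smul_eq_zero_iff_right two_ne_zero]

theorem torsion_eq_zero_iff (L Γ : VectorOneForm E M) :
    torsion L Γ = 0 ↔ endBracket lieBilin (appEnd L) (appEnd (hor Γ)) = 0 := by
  rw [torsion, smul_eq_zero_iff_right one_half_pos.ne', fnBracket_eq_zero_iff, appEnd_hor,
    endBracket_smul_one_add, smul_eq_zero_iff_right one_half_pos.ne']

theorem curvature_eq_zero_iff (Γ : VectorOneForm E M) :
    curvature Γ = 0 ↔ nijenhuis lieBilin (appEnd (hor Γ)) = 0 := by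
  rw [curvature, neg_eq_zero, smul_eq_zero_iff_right one_half_pos.ne', fnBracket_self_eq_zero_iff]

theorem IsAlmostTangent.nijenhuis_eq_zero {L : VectorOneForm E M} (hL : IsAlmostTangent L) :
    LConn.nijenhuis lieBilin (appEnd L) = 0 :=
  (fnBracket_self_eq_zero_iff L).1 <| (smul_eq_zero_iff_right one_half_pos.ne').1 hL.nijenhuis

theorem IsAlmostTangent.isAdapted {L Γ F : VectorOneForm E M} (hL : IsAlmostTangent L)
    (hΓ : IsLConnection L Γ) (hF : IsAssociated L Γ F) : IsAdapted (appEnd L) (appEnd F) := by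
  have hk := eq_zero_iff_of_range_eq_ker hL.range_eq_ker
  have F_hor : appEnd F * (appEnd F * appEnd L) = -appEnd L := by
    rw [hF.appEnd_mul_appEnd]
    exact LinearMap.ext fun X => ContMDiffSection.ext fun z => hF.comp_hor z (X z)
  have hor_add_ver : appEnd F * appEnd L + appEnd L * appEnd F = 1 := by
    rw [hF.appEnd_mul_appEnd, add_comm]
    exact LinearMap.ext fun X => ContMDiffSection.ext fun z =>
      comp_pointwise (L := (L z).toLinearMap) (Γ := (Γ z).toLinearMap) (F := (F z).toLinearMap)
        (hk z) (hΓ.comp_right z) (hF.comp_L z) (hF.comp_hor z) (X z)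
  exact {
    L_mul_L := LinearMap.ext fun X => ContMDiffSection.ext fun z => (hk z _).2 ⟨X z, rfl⟩
    F_mul_F := mul_self_eq_neg_one_of_mul_add_mul_eq_one hor_add_ver F_hor
    F_mul_L_add_L_mul_F := hor_add_ver }

end Manifold

end LConn

theorem theorem9_general {E : Type*} [NormedAddCommGroup E] [NormedSpace ℝ E]
    [FiniteDimensional ℝ E] {M : Type*} [TopologicalSpace M] [ChartedSpace E M]
    [IsManifold 𝓘(ℝ, E) ∞ M] {L Γ F : LConn.VectorOneForm E M} (hL : LConn.IsAlmostTangent L)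
    (hΓ : LConn.IsLConnection L Γ) (hF : LConn.IsAssociated L Γ F) :
    List.TFAE [
      LConn.fnBracket F F = 0,
      LConn.torsion L Γ = 0 ∧ LConn.curvature Γ = 0,
      LConn.fnBracket L F = 0,
      LConn.fnBracket (LConn.hor Γ) F = 0] := by
  rw [LConn.fnBracket_self_eq_zero_iff, LConn.torsion_eq_zero_iff, LConn.curvature_eq_zero_iff,
    LConn.fnBracket_eq_zero_iff, LConn.fnBracket_eq_zero_iff, ← hF.appEnd_mul_appEnd]
  exact (hL.isAdapted hΓ hF).tfae_nijenhuis_F_eq_zero hL.nijenhuis_eq_zero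

theorem theorem9 {E : Type*} [NormedAddCommGroup E] [NormedSpace ℝ E] [FiniteDimensional ℝ E]
    {M : Type*} [TopologicalSpace M] [ChartedSpace E M] [IsManifold 𝓘(ℝ, E) ∞ M]
    [T2Space M] [ParacompactSpace M]
    (L Γ : LConn.VectorOneForm E M)
    (hL : LConn.IsAlmostTangent L) (hΓ : LConn.IsLConnection L Γ) :
    List.TFAE [
      LConn.fnBracket (LConn.almostComplex hL hΓ) (LConn.almostComplex hL hΓ) = 0,
      LConn.torsion L Γ = 0 ∧ LConn.curvature Γ = 0,
      LConn.fnBracket L (LConn.almostComplex hL hΓ) = 0,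
      LConn.fnBracket (LConn.hor Γ) (LConn.almostComplex hL hΓ) = 0] :=
  theorem9_general hL hΓ (LConn.almostComplex_isAssociated hL hΓ)
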